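/- Let $\kappa>0$ and put $D_\kappa=\pi/\sqrt{\kappa}$. Let $(M,d)$ be a complete CAT$(\kappa)$ space with $\mathrm{diam}(M)<D_\kappa/2$. Let $A$ and $B$ be non-empty closed convex subsets of $M$ with $A\cap B\neq\emptyset$, where a subset $C\subseteq M$ is called convex if any two points of $C$ are joined by a geodesic of $M$ and the segment of every such geodesic is contained in $C$. For $x\in M$ and a non-empty closed convex set $C\subseteq M$, write $d(x,C)=\inf_{c\in C}d(x,c)$ and let $P_C(x)$ be the metric projection of $x$ onto $C$, that is, the unique point of $C$ with $d(x,P_C(x))=d(x,C)$. Let $x_0\in M$ be a starting point, and let $\{x_n\}$ be the sequence produced by the alternating projection method, \[ x_{2n-1}=P_A(x_{2n-2}),\qquad x_{2n}=P_B(x_{2n-1}),\qquad n=1,2,\dots . \] Then the following hold. (i) $\{x_n\}$ $\Delta$-converges to a point $x\in A\cap B$; that is, for every subsequence $\{x_{n_k}\}$ of $\{x_n\}$, the point $x$ is the unique minimizer over $M$ of the function $y\mapsto\limsup_{k\to\infty}d(y,x_{n_k})$. (ii) If $A$ and $B$ are boundedly regular, that is, if for every bounded set $S\subseteq M$ and every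 $\epsilon>0$ there is $\delta>0$ such that $d(x,A\cap B)\le\epsilon$ for all $x\in S$ with $\max\{d(x,A),d(x,B)\}\le\delta$, then $\{x_n\}$ converges to a point of $A\cap B$. (iii) If $A$ and $B$ are boundedly linearly regular, that is, if for every bounded set $S\subseteq M$ there is $k>0$ such that $d(x,A\cap B)\le k\max\{d(x,A),d(x,B)\}$ for all $x\in S$, then $\{x_n\}$ converges linearly to a point $x\in A\cap B$; that is, there are $K\ge 0$ and $\alpha\in[0,1)$ with $d(x_n,x)\le K\alpha^n$ for all $n$. -/

import Mathlib

open Set Filter Topology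

noncomputable section

namespace CATSpace

/-- `γ : [0,1] → X` (encoded as a map on `ℝ`, only its restriction to `[0,1]` matters) is a
geodesic joining `x` and `y`. -/
structure IsGeodesic {X : Type*} [Dist X] (γ : ℝ → X) (x y : X) : Prop where
  source : γ 0 = x
  target : γ 1 = y
  dist_eq : ∀ s ∈ Icc (0 : ℝ) 1, ∀ t ∈ Icc (0 : ℝ) 1, dist (γ s) (γ t) = dist x y * |s - t|

/-- `S` is a geodesic segment joining `x` and `y`. -/
def IsGeodesicSegment {X : Type*} [Dist X] (S : Set X) (x y : X) : Prop :=
  ∃ γ : ℝ → X, IsGeodesic γ x y ∧ S = γ '' Icc (0 : ℝ) 1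

/-- `X` is a `D`-geodesic space. -/
def IsDGeodesicSpace (X : Type*) [Dist X] (D : ℝ) : Prop :=
  ∀ x y : X, dist x y < D → ∃ γ : ℝ → X, IsGeodesic γ x y

/-- `C` is convex: any two of its points are joined by a geodesic of the ambient space, and the
segment of every such geodesic is contained in `C`. -/
def IsGeodesicallyConvex {X : Type*} [Dist X] (C : Set X) : Prop :=
  ∀ x ∈ C, ∀ y ∈ C,
    (∃ γ : ℝ → X, IsGeodesic γ x y) ∧
      ∀ γ : ℝ → X, IsGeodesic γ x y → γ '' Icc (0 : ℝ) 1 ⊆ C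

/-- `D_κ = π / √κ`. -/
def modelDiam (κ : ℝ) : ℝ := Real.pi / Real.sqrt κ

/-- The points of the model surface `M_κ²` (`κ > 0`): the unit sphere of `ℝ³`. -/
def ModelSurface (_κ : ℝ) : Type :=
  {u : EuclideanSpace ℝ (Fin 3) // inner ℝ u u = (1 : ℝ)}

/-- The distance of `M_κ²`: the angular distance of the unit sphere, multiplied by `1 / √κ`. -/
instance modelSurfaceDist (κ : ℝ) : Dist (ModelSurface κ) where
  dist u v := 1 / Real.sqrt κ * Real.arccos (inner ℝ u.1 v.1)

/-- A geodesic triangle: three vertices and three geodesic segments; `side i` joins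
`vertex i` and `vertex (i + 1)`, indices modulo `3`. -/
structure GeodesicTriangle (X : Type*) [Dist X] where
  vertex : Fin 3 → X
  side : Fin 3 → Set X
  isSegment : ∀ i, IsGeodesicSegment (side i) (vertex i) (vertex (i + 1))

/-- The perimeter of a geodesic triangle. -/
def GeodesicTriangle.perimeter {X : Type*} [Dist X] (T : GeodesicTriangle X) : ℝ :=
  ∑ i, dist (T.vertex i) (T.vertex (i + 1))

/-- `T'` is a comparison triangle in `M_κ²` for `T`. -/
def IsComparisonTriangle {X : Type*} [Dist X] {κ : ℝ} (T : GeodesicTriangle X)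
    (T' : GeodesicTriangle (ModelSurface κ)) : Prop :=
  ∀ i, dist (T.vertex i) (T.vertex (i + 1)) = dist (T'.vertex i) (T'.vertex (i + 1))

/-- `p'` on the `i`-th side of `T'` is a comparison point for `p` on the `i`-th side of `T`. -/
def IsComparisonPoint {X : Type*} [Dist X] {κ : ℝ} (T : GeodesicTriangle X)
    (T' : GeodesicTriangle (ModelSurface κ)) (i : Fin 3) (p : X) (p' : ModelSurface κ) : Prop :=
  p ∈ T.side i ∧ p' ∈ T'.side i ∧ dist p (T.vertex i) = dist p' (T'.vertex i)

/-- `T` satisfies the CAT(`κ`) inequality. -/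
def SatisfiesCATInequality {X : Type*} [Dist X] (κ : ℝ) (T : GeodesicTriangle X) : Prop :=
  ∀ T' : GeodesicTriangle (ModelSurface κ), IsComparisonTriangle T T' →
    ∀ (i j : Fin 3) (p q : X) (p' q' : ModelSurface κ),
      IsComparisonPoint T T' i p p' → IsComparisonPoint T T' j q q' → dist p q ≤ dist p' q'

/-- `X` is a CAT(`κ`) space (`κ > 0`). -/
structure IsCAT (κ : ℝ) (X : Type*) [MetricSpace X] : Prop where
  geodesic : IsDGeodesicSpace X (modelDiam κ)
  comparison : ∀ T : GeodesicTriangle X,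
    T.perimeter < 2 * modelDiam κ → SatisfiesCATInequality κ T

open Classical in
/-- The metric projection onto `C`: the unique point of `C` at distance `d(x, C)` from `x`.
If there is no unique such point, the value is `x` itself. -/
def metricProj {X : Type*} [MetricSpace X] (C : Set X) (x : X) : X :=
  if h : ∃! p, p ∈ C ∧ dist x p = Metric.infDist x C then h.choose else x

/-- `x 0, x 1, …` is produced by the alternating projection method from the starting point `x 0`:
`x (2n+1) = P_A (x (2n))` and `x (2n+2) = P_B (x (2n+1))` for all `n ≥ 0`. -/
def IsAlternatingProjection {X : Type*} [MetricSpace X] (A B : Set X) (x : ℕ → X) : Prop :=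
  ∀ n : ℕ, x (2 * n + 1) = metricProj A (x (2 * n)) ∧
    x (2 * n + 2) = metricProj B (x (2 * n + 1))

/-- `r(p, {xₙ}) = limsup d(p, xₙ)`, for a bounded sequence. -/
def radiusAt {X : Type*} [MetricSpace X] (p : X) (x : ℕ → X) : ℝ :=
  limsup (fun n => dist p (x n)) atTop

/-- The asymptotic radius of a bounded sequence. -/
def asymptoticRadius {X : Type*} [MetricSpace X] (x : ℕ → X) : ℝ :=
  ⨅ p : X, radiusAt p x

/-- The asymptotic center of a bounded sequence. -/
def asymptoticCenter {X : Type*} [MetricSpace X] (x : ℕ → X) : Set X :=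
  {p | radiusAt p x = asymptoticRadius x}

/-- The (bounded) sequence `x` `Δ`-converges to `p`: `p` is the unique asymptotic center of every
subsequence. -/
def DeltaConverges {X : Type*} [MetricSpace X] (x : ℕ → X) (p : X) : Prop :=
  ∀ φ : ℕ → ℕ, StrictMono φ → asymptoticCenter (x ∘ φ) = {p}

/-- `x` converges linearly to `p`. -/
def ConvergesLinearly {X : Type*} [MetricSpace X] (x : ℕ → X) (p : X) : Prop :=
  ∃ K α : ℝ, 0 ≤ K ∧ 0 ≤ α ∧ α < 1 ∧ ∀ n : ℕ, dist (x n) p ≤ K * α ^ n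

/-- `A` and `B` are boundedly regular. -/
def BoundedlyRegular {X : Type*} [MetricSpace X] (A B : Set X) : Prop :=
  ∀ S : Set X, Bornology.IsBounded S → ∀ ε : ℝ, 0 < ε → ∃ δ : ℝ, 0 < δ ∧
    ∀ x ∈ S, max (Metric.infDist x A) (Metric.infDist x B) ≤ δ → Metric.infDist x (A ∩ B) ≤ ε

/-- `A` and `B` are boundedly linearly regular. -/
def BoundedlyLinearlyRegular {X : Type*} [MetricSpace X] (A B : Set X) : Prop :=
  ∀ S : Set X, Bornology.IsBounded S → ∃ k : ℝ, 0 < k ∧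
    ∀ x ∈ S, Metric.infDist x (A ∩ B) ≤ k * max (Metric.infDist x A) (Metric.infDist x B)

end CATSpace

end

/-! Scaled by `√κ`, all distances lie below a fixed `R < π / 2`, where cosine is positive and
strictly decreasing. Comparison with an explicit spherical triangle turns the CAT condition into a
trigonometric inequality along geodesics (`IsCAT.sin_mul_cos_le`), and everything later rests on
that inequality, packaged in `IsSmallCAT`.

It is used in two ways. At midpoints it gives a uniform concavity of cosines, so minimizing
sequences are Cauchy (`exists_unique_minimizer`); this yields metric projections and asymptotic
centers. Near the foot of a projection it gives a spherical Pythagorean inequality, cos d(x,c) ≤ cos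
d(x,Px) · cos d(Px,c) in scaled distances (`cos_dist_le_of_isNearest`).

For q in A ∩ B, Pythagoras makes d(x_n,q) decrease. The cosines of these distances have a positive
limit, so the step lengths tend to 0, and with them the distances to A and to B. (i) Asymptotic
centers of subsequences therefore lie in A ∩ B, where the radius is a genuine limit and does not
depend on the subsequence; so all these centers coincide. (ii) Bounded regularity gives d(x_n, A ∩
B) → 0, and a Fejér monotone sequence with this property is Cauchy. (iii) Linear regularity bounds
each step below by a multiple of d(x_n, A ∩ B); Pythagoras then contracts the sine of that distance
by a fixed factor. -/

namespace CATSpace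

/-! ### Spherical trigonometry and triangles in the model surface. -/

/-- Spherical law of cosines, solved for the (unit) direction of the third vertex. -/
lemma exists_unit_direction {a b c : ℝ} (ha : 0 ≤ a) (hb : 0 ≤ b) (hc : 0 ≤ c)
    (hab : a + b ≤ Real.pi) (hcp : c ≤ Real.pi)
    (h1 : c ≤ a + b) (h2 : a ≤ b + c) (h3 : b ≤ a + c) :
    ∃ p q : ℝ, p ^ 2 + q ^ 2 = 1 ∧
      Real.cos c = Real.cos a * Real.cos b + Real.sin a * Real.sin b * p := by
  have hlow : Real.cos (a + b) ≤ Real.cos c := Real.cos_le_cos_of_nonneg_of_le_pi hc hab h1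
  have hupp : Real.cos c ≤ Real.cos (a - b) := by
    rw [← Real.cos_abs (a - b)]
    exact Real.cos_le_cos_of_nonneg_of_le_pi (abs_nonneg _) hcp
      (abs_le.2 ⟨by linarith, by linarith⟩)
  rw [Real.cos_add] at hlow
  rw [Real.cos_sub] at hupp
  have hsa : 0 ≤ Real.sin a := Real.sin_nonneg_of_nonneg_of_le_pi ha (by linarith)
  have hsb : 0 ≤ Real.sin b := Real.sin_nonneg_of_nonneg_of_le_pi hb (by linarith)
  rcases (mul_nonneg hsa hsb).eq_or_lt with h0 | h0
  -- Degenerate case: the two bounds on `cos c` collapse to `cos a * cos b`, so any unit direction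
  -- will do.
  · exact ⟨1, 0, by norm_num, by nlinarith⟩
  · set p := (Real.cos c - Real.cos a * Real.cos b) / (Real.sin a * Real.sin b) with hp
    have hp1 : p ≤ 1 := by rw [hp, div_le_one h0]; linarith
    have hp2 : -1 ≤ p := by rw [hp, le_div_iff₀ h0]; linarith
    refine ⟨p, Real.sqrt (1 - p ^ 2), ?_, ?_⟩
    · rw [Real.sq_sqrt (by nlinarith)]; ring
    · rw [hp, mul_div_cancel₀ _ h0.ne']; ring

lemma modelSurface_dist_eq {κ : ℝ} (u v : ModelSurface κ) :
    dist u v = 1 / Real.sqrt κ * Real.arccos (inner ℝ u.1 v.1) := rfl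

lemma modelSurface_dist_self {κ : ℝ} (u : ModelSurface κ) : dist u u = 0 := by
  rw [modelSurface_dist_eq, u.2, Real.arccos_one, mul_zero]

lemma inner_cos_sin {u w : EuclideanSpace ℝ (Fin 3)} (hu : inner ℝ u u = (1 : ℝ))
    (hw : inner ℝ w w = (1 : ℝ)) (huw : inner ℝ u w = (0 : ℝ)) (α β : ℝ) :
    inner ℝ (Real.cos α • u + Real.sin α • w) (Real.cos β • u + Real.sin β • w) =
      Real.cos (α - β) := by
  have hwu : inner ℝ w u = (0 : ℝ) := by rw [real_inner_comm]; exact huw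
  simp only [inner_add_left, inner_add_right, real_inner_smul_left, real_inner_smul_right,
    hu, hw, huw, hwu, Real.cos_sub]
  ring

/-- The point at angle `α` on the great circle through `u` in the direction `w`. -/
noncomputable def greatCircle (κ : ℝ) {u w : EuclideanSpace ℝ (Fin 3)}
    (hu : inner ℝ u u = (1 : ℝ)) (hw : inner ℝ w w = (1 : ℝ)) (huw : inner ℝ u w = (0 : ℝ))
    (α : ℝ) : ModelSurface κ :=
  ⟨Real.cos α • u + Real.sin α • w, by rw [inner_cos_sin hu hw huw, sub_self, Real.cos_zero]⟩

lemma dist_greatCircle {κ : ℝ} {u w : EuclideanSpace ℝ (Fin 3)}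
    (hu : inner ℝ u u = (1 : ℝ)) (hw : inner ℝ w w = (1 : ℝ)) (huw : inner ℝ u w = (0 : ℝ))
    {α β : ℝ} (h : |α - β| ≤ Real.pi) :
    dist (greatCircle κ hu hw huw α) (greatCircle κ hu hw huw β) =
      1 / Real.sqrt κ * |α - β| := by
  rw [modelSurface_dist_eq]
  simp only [greatCircle]
  rw [inner_cos_sin hu hw huw, ← Real.cos_abs, Real.arccos_cos (abs_nonneg _) h]

lemma isGeodesic_greatCircle {κ : ℝ} {u w : EuclideanSpace ℝ (Fin 3)}
    (hu : inner ℝ u u = (1 : ℝ)) (hw : inner ℝ w w = (1 : ℝ)) (huw : inner ℝ u w = (0 : ℝ))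
    {θ : ℝ} (h0 : 0 ≤ θ) (hθ : θ ≤ Real.pi) :
    IsGeodesic (fun t => greatCircle κ hu hw huw (t * θ))
      (greatCircle κ hu hw huw 0) (greatCircle κ hu hw huw θ) := by
  refine ⟨by simp, by simp, fun s hs t ht => ?_⟩
  have hst : |s - t| ≤ 1 := abs_le.2 ⟨by linarith [hs.1, ht.2], by linarith [hs.2, ht.1]⟩
  have hmul : |s * θ - t * θ| = |s - t| * θ := by rw [← sub_mul, abs_mul, abs_of_nonneg h0]
  rw [dist_greatCircle hu hw huw (by rw [hmul]; nlinarith), hmul,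
    dist_greatCircle hu hw huw (by rwa [zero_sub, abs_neg, abs_of_nonneg h0]),
    zero_sub, abs_neg, abs_of_nonneg h0]
  ring

/-- Non-antipodal points of the model surface are joined by a geodesic. -/
lemma exists_isGeodesic_modelSurface {κ : ℝ} (u v : ModelSurface κ)
    (h : Real.arccos (inner ℝ u.1 v.1) < Real.pi) :
    ∃ γ : ℝ → ModelSurface κ, IsGeodesic γ u v := by
  have hun : ‖u.1‖ = 1 := by
    have := real_inner_self_eq_norm_sq u.1
    rw [u.2] at this
    nlinarith [norm_nonneg u.1]
  have hvn : ‖v.1‖ = 1 := by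
    have := real_inner_self_eq_norm_sq v.1
    rw [v.2] at this
    nlinarith [norm_nonneg v.1]
  have hle := abs_le.1 (abs_real_inner_le_norm u.1 v.1)
  rw [hun, hvn, mul_one] at hle
  set θ := Real.arccos (inner ℝ u.1 v.1) with hθ
  have hcos : Real.cos θ = inner ℝ u.1 v.1 := Real.cos_arccos hle.1 hle.2
  rcases (Real.arccos_nonneg (inner ℝ u.1 v.1)).eq_or_lt with h0 | h0
  · have h1 : inner ℝ u.1 v.1 = (1 : ℝ) := by rw [← hcos, hθ, ← h0, Real.cos_zero]
    have huv : u = v := Subtype.ext ((inner_eq_one_iff_of_norm_eq_one hun hvn).1 h1)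
    subst huv
    exact ⟨fun _ => u, rfl, rfl, fun s _ t _ => by rw [modelSurface_dist_self, zero_mul]⟩
  · have hs : 0 < Real.sin θ := Real.sin_pos_of_pos_of_lt_pi h0 h
    -- Gram–Schmidt: the unit tangent vector at `u` pointing towards `v`.
    set w : EuclideanSpace ℝ (Fin 3) := (Real.sin θ)⁻¹ • (v.1 - Real.cos θ • u.1) with hw
    have huw : inner ℝ u.1 w = (0 : ℝ) := by
      rw [hw, real_inner_smul_right, inner_sub_right, real_inner_smul_right, u.2, ← hcos]
      ring
    have hww : inner ℝ w w = (1 : ℝ) := by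
      rw [hw]
      simp only [real_inner_smul_right, real_inner_smul_left, inner_sub_right, inner_sub_left,
        u.2, v.2, real_inner_comm u.1 v.1, ← hcos]
      field_simp
      nlinarith [Real.sin_sq_add_cos_sq θ]
    have hg := isGeodesic_greatCircle (κ := κ) u.2 hww huw h0.le h.le
    have e0 : greatCircle κ u.2 hww huw 0 = u := Subtype.ext (by simp [greatCircle])
    have e1 : greatCircle κ u.2 hww huw θ = v := Subtype.ext (by
      simp only [greatCircle, hw, smul_smul, mul_inv_cancel₀ hs.ne', one_smul]
      abel)
    rw [← hθ, e0, e1] at hg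
    exact ⟨_, hg⟩

/-- Three lengths satisfying the triangle inequalities are realised by a triangle in the model
surface, with one side an explicit great circle arc. -/
lemma exists_modelSurface_triangle (κ : ℝ) {a b c : ℝ} (ha : 0 ≤ a) (hb : 0 ≤ b) (hc : 0 ≤ c)
    (hab : a + b < Real.pi) (hcp : c < Real.pi)
    (h1 : c ≤ a + b) (h2 : a ≤ b + c) (h3 : b ≤ a + c) :
    ∃ (γ : ℝ → ModelSurface κ) (w : ModelSurface κ), IsGeodesic γ (γ 0) (γ 1) ∧
      Real.arccos (inner ℝ (γ 0).1 (γ 1).1) = a ∧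
      Real.arccos (inner ℝ (γ 1).1 w.1) = c ∧
      Real.arccos (inner ℝ w.1 (γ 0).1) = b ∧
      ∀ t, Real.sin a * inner ℝ (γ t).1 w.1 =
        Real.sin ((1 - t) * a) * Real.cos b + Real.sin (t * a) * Real.cos c := by
  obtain ⟨p, q, hpq, hcos⟩ := exists_unit_direction ha hb hc hab.le hcp.le h1 h2 h3
  let e : Fin 3 → EuclideanSpace ℝ (Fin 3) := fun i => EuclideanSpace.single i 1
  have he : ∀ i j, inner ℝ (e i) (e j) = if i = j then (1 : ℝ) else 0 := by
    intro i j
    simp [e, EuclideanSpace.inner_single_left]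
  have hu : inner ℝ (e 0) (e 0) = (1 : ℝ) := by rw [he]; simp
  have hw : inner ℝ (e 1) (e 1) = (1 : ℝ) := by rw [he]; simp
  have huw : inner ℝ (e 0) (e 1) = (0 : ℝ) := by rw [he]; simp
  -- The third vertex in polar coordinates around `e 0`: angle `b`, direction `(p, q)` in the
  -- tangent plane, with `p` fixed by the law of cosines.
  let w : EuclideanSpace ℝ (Fin 3) :=
    Real.cos b • e 0 + (Real.sin b * p) • e 1 + (Real.sin b * q) • e 2
  have hwin : ∀ α, inner ℝ (Real.cos α • e 0 + Real.sin α • e 1) w =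
      Real.cos α * Real.cos b + Real.sin α * Real.sin b * p := by
    intro α
    simp only [w, inner_add_left, inner_add_right, real_inner_smul_left, real_inner_smul_right, he]
    simp
    ring
  have hww : inner ℝ w w = (1 : ℝ) := by
    simp only [w, inner_add_left, inner_add_right, real_inner_smul_left, real_inner_smul_right, he]
    simp
    linear_combination Real.sin b ^ 2 * hpq + Real.sin_sq_add_cos_sq b
  refine ⟨fun t => greatCircle κ hu hw huw (t * a), ⟨w, hww⟩, ?_, ?_, ?_, ?_, ?_⟩
  · have := isGeodesic_greatCircle (κ := κ) hu hw huw ha (by linarith)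
    simpa using this
  · simp only [greatCircle]
    rw [inner_cos_sin hu hw huw, zero_mul, one_mul, zero_sub, Real.cos_neg,
      Real.arccos_cos ha (by linarith)]
  · simp only [greatCircle]
    rw [hwin, one_mul, ← hcos, Real.arccos_cos hc hcp.le]
  · rw [real_inner_comm]
    simp only [greatCircle]
    rw [hwin, zero_mul, Real.cos_zero, Real.sin_zero]
    simpa using Real.arccos_cos hb (by linarith)
  · intro t
    simp only [greatCircle]
    rw [hwin, sub_mul, one_mul, Real.sin_sub, hcos]
    ring

/-! ### From comparison triangles to a trigonometric inequality. -/

/-- The CAT(`κ`) inequality for a vertex and a point on the opposite side, in trigonometric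
form. -/
theorem IsCAT.sin_mul_cos_le {X : Type*} [MetricSpace X] {κ : ℝ} (hκ : 0 < κ) (hX : IsCAT κ X)
    {x y z : X} {γ : ℝ → X} (hγ : IsGeodesic γ y z)
    (hyz : dist y z < modelDiam κ / 2) (hyx : dist x y < modelDiam κ / 2)
    (hzx : dist x z < modelDiam κ / 2) {t : ℝ} (ht : t ∈ Icc (0 : ℝ) 1) :
    Real.sin ((1 - t) * (Real.sqrt κ * dist y z)) * Real.cos (Real.sqrt κ * dist x y) +
        Real.sin (t * (Real.sqrt κ * dist y z)) * Real.cos (Real.sqrt κ * dist x z) ≤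
      Real.sin (Real.sqrt κ * dist y z) * Real.cos (Real.sqrt κ * dist x (γ t)) := by
  have hs : 0 < Real.sqrt κ := Real.sqrt_pos.2 hκ
  set s := Real.sqrt κ with hsdef
  have hD : s * (modelDiam κ / 2) = Real.pi / 2 := by
    rw [modelDiam, ← hsdef]; field_simp
  have hDpos : 0 < modelDiam κ := by rw [modelDiam]; positivity
  have hlt : ∀ r, r < modelDiam κ / 2 → s * r < Real.pi / 2 := fun r hr => by
    rw [← hD]; exact mul_lt_mul_of_pos_left hr hs
  have ha := hlt _ hyz
  have hb := hlt _ hyx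
  have hc := hlt _ hzx
  have ha0 : 0 ≤ s * dist y z := by positivity
  obtain ⟨σ, w, hσ, e01, e12, e20, hin⟩ := exists_modelSurface_triangle κ (a := s * dist y z)
    (b := s * dist x y) (c := s * dist x z) ha0 (by positivity) (by positivity)
    (by linarith) (by linarith)
    (by rw [← mul_add]; gcongr; linarith [dist_triangle x y z])
    (by rw [← mul_add]; gcongr; linarith [dist_triangle y x z, dist_comm x y])
    (by rw [← mul_add]; gcongr; linarith [dist_triangle x z y, dist_comm z y])
  obtain ⟨γ₁, hγ₁⟩ := hX.geodesic z x (by rw [dist_comm]; linarith)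
  obtain ⟨γ₂, hγ₂⟩ := hX.geodesic x y (by linarith)
  obtain ⟨σ₁, hσ₁⟩ := exists_isGeodesic_modelSurface (σ 1) w (by rw [e12]; linarith)
  obtain ⟨σ₂, hσ₂⟩ := exists_isGeodesic_modelSurface w (σ 0) (by rw [e20]; linarith)
  -- The vertices are ordered so that side `0` is `γ`, while `x` is the starting point of side `2`
  -- and so is its own comparison point there.
  let T : GeodesicTriangle X :=
    { vertex := ![y, z, x]
      side := ![γ '' Icc 0 1, γ₁ '' Icc 0 1, γ₂ '' Icc 0 1]
      isSegment := by
        intro i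
        fin_cases i
        · exact ⟨γ, hγ, rfl⟩
        · exact ⟨γ₁, hγ₁, rfl⟩
        · exact ⟨γ₂, hγ₂, rfl⟩ }
  let T' : GeodesicTriangle (ModelSurface κ) :=
    { vertex := ![σ 0, σ 1, w]
      side := ![σ '' Icc 0 1, σ₁ '' Icc 0 1, σ₂ '' Icc 0 1]
      isSegment := by
        intro i
        fin_cases i
        · exact ⟨σ, hσ, rfl⟩
        · exact ⟨σ₁, hσ₁, rfl⟩
        · exact ⟨σ₂, hσ₂, rfl⟩ }
  have d01 : dist (σ 0) (σ 1) = dist y z := by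
    rw [modelSurface_dist_eq, e01, ← hsdef]; field_simp
  have d12 : dist (σ 1) w = dist z x := by
    rw [modelSurface_dist_eq, e12, ← hsdef, dist_comm z x]; field_simp
  have d20 : dist w (σ 0) = dist x y := by
    rw [modelSurface_dist_eq, e20, ← hsdef]; field_simp
  have hper : T.perimeter < 2 * modelDiam κ := by
    have : T.perimeter = dist y z + dist z x + dist x y := by
      simp [GeodesicTriangle.perimeter, Fin.sum_univ_three, T]
    rw [this, dist_comm z x]
    linarith
  have hcomp : IsComparisonTriangle T T' := by
    intro i
    fin_cases i
    · exact d01.symm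
    · exact d12.symm
    · exact d20.symm
  have h0 : (0 : ℝ) ∈ Icc (0 : ℝ) 1 := by simp
  have hp : IsComparisonPoint T T' 0 (γ t) (σ t) := by
    refine ⟨⟨t, ht, rfl⟩, ⟨t, ht, rfl⟩, ?_⟩
    have e1 := hγ.dist_eq t ht 0 h0
    have e2 := hσ.dist_eq t ht 0 h0
    rw [hγ.source] at e1
    change dist (γ t) y = dist (σ t) (σ 0)
    rw [e1, e2, d01]
  have hq : IsComparisonPoint T T' 2 x w := by
    refine ⟨⟨0, h0, hγ₂.source⟩, ⟨0, h0, hσ₂.source⟩, ?_⟩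
    change dist x x = dist w w
    rw [modelSurface_dist_self, dist_self]
  have hle := hX.comparison T hper T' hcomp 0 2 _ _ _ _ hp hq
  rw [modelSurface_dist_eq, ← hsdef, one_div, inv_mul_eq_div, le_div_iff₀ hs, mul_comm,
    dist_comm] at hle
  have hle2 : inner ℝ (σ t).1 w.1 ≤ Real.cos (s * dist x (γ t)) := by
    have h := Real.cos_le_cos_of_nonneg_of_le_pi (by positivity) (Real.arccos_le_pi _) hle
    -- `cos (arccos r) = r` needs `|r| ≤ 1`. Cauchy–Schwarz rules out `r > 1`; for `r < -1` the goal
    -- is trivial.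
    rcases le_or_gt (-1) (inner ℝ (σ t).1 w.1) with h1 | h1
    · refine le_trans ?_ h
      rcases le_or_gt (inner ℝ (σ t).1 w.1) 1 with h2 | h2
      · rw [Real.cos_arccos h1 h2]
      · exfalso
        have h3 := real_inner_le_norm (σ t).1 w.1
        have h4 := real_inner_self_eq_norm_sq (σ t).1
        have h5 := real_inner_self_eq_norm_sq w.1
        rw [(σ t).2] at h4
        rw [w.2] at h5
        nlinarith [norm_nonneg (σ t).1, norm_nonneg w.1, sq_nonneg (‖(σ t).1‖ - ‖w.1‖)]
    · exact h1.le.trans (Real.neg_one_le_cos _)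
  rw [← hin t]
  exact mul_le_mul_of_nonneg_left hle2
    (Real.sin_nonneg_of_nonneg_of_le_pi ha0 (by linarith))

/-- A geodesic space in which all distances, scaled by `s`, are at most `R < π / 2`, and geodesic
triangles satisfy the trigonometric form of the CAT(`s ^ 2`) inequality. -/
structure IsSmallCAT (X : Type*) [MetricSpace X] (s R : ℝ) : Prop where
  scale_pos : 0 < s
  bound_lt : R < Real.pi / 2
  dist_le : ∀ x y : X, s * dist x y ≤ R
  geodesic : ∀ x y : X, ∃ γ : ℝ → X, IsGeodesic γ x y
  sin_mul_cos_le : ∀ (x y z : X) (γ : ℝ → X), IsGeodesic γ y z → ∀ t ∈ Icc (0 : ℝ) 1,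
    Real.sin ((1 - t) * (s * dist y z)) * Real.cos (s * dist x y) +
        Real.sin (t * (s * dist y z)) * Real.cos (s * dist x z) ≤
      Real.sin (s * dist y z) * Real.cos (s * dist x (γ t))

/-- The strict diameter bound puts the scaled diameter strictly below `π / 2`. This uniform gap
keeps cosines of distances, and of their limits, away from zero. -/
theorem IsCAT.isSmallCAT {X : Type*} [MetricSpace X] {κ : ℝ} (hκ : 0 < κ) (hX : IsCAT κ X)
    (hdiam : Metric.ediam (Set.univ : Set X) < ENNReal.ofReal (modelDiam κ / 2)) :
    IsSmallCAT X (Real.sqrt κ) (Real.sqrt κ * (Metric.ediam (Set.univ : Set X)).toReal) := by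
  have hs : 0 < Real.sqrt κ := Real.sqrt_pos.2 hκ
  have hD : 0 < modelDiam κ := by rw [modelDiam]; positivity
  have htop : Metric.ediam (Set.univ : Set X) ≠ ⊤ := hdiam.ne_top
  have hlt : (Metric.ediam (Set.univ : Set X)).toReal < modelDiam κ / 2 :=
    (ENNReal.lt_ofReal_iff_toReal_lt htop).1 hdiam
  have hdist : ∀ x y : X, dist x y ≤ (Metric.ediam (Set.univ : Set X)).toReal := fun x y => by
    rw [dist_edist]
    exact ENNReal.toReal_mono htop (Metric.edist_le_ediam_of_mem (mem_univ x) (mem_univ y))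
  refine ⟨hs, ?_, fun x y => mul_le_mul_of_nonneg_left (hdist x y) hs.le, fun x y => ?_, ?_⟩
  · calc Real.sqrt κ * (Metric.ediam (Set.univ : Set X)).toReal
        < Real.sqrt κ * (modelDiam κ / 2) := mul_lt_mul_of_pos_left hlt hs
      _ = Real.pi / 2 := by rw [modelDiam]; field_simp
  · exact hX.geodesic x y (by linarith [hdist x y])
  · intro x y z γ hγ t ht
    exact hX.sin_mul_cos_le hκ hγ (by linarith [hdist y z]) (by linarith [hdist x y])
      (by linarith [hdist x z]) ht

/-! ### Convexity, comparison of cosines and unique minimizers. -/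

lemma IsGeodesicallyConvex.inter {X : Type*} [Dist X] {A B : Set X}
    (hA : IsGeodesicallyConvex A) (hB : IsGeodesicallyConvex B) :
    IsGeodesicallyConvex (A ∩ B) := fun x hx y hy =>
  ⟨(hA x hx.1 y hy.1).1, fun γ hγ =>
    subset_inter ((hA x hx.1 y hy.1).2 γ hγ) ((hB x hx.2 y hy.2).2 γ hγ)⟩

namespace IsSmallCAT

variable {X : Type*} [MetricSpace X] {s R : ℝ}

lemma scaled_nonneg (h : IsSmallCAT X s R) (x y : X) : 0 ≤ s * dist x y :=
  mul_nonneg h.scale_pos.le dist_nonneg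

lemma cos_scaled_pos (h : IsSmallCAT X s R) (x y : X) : 0 < Real.cos (s * dist x y) :=
  Real.cos_pos_of_mem_Ioo ⟨by linarith [h.scaled_nonneg x y, Real.pi_pos],
    (h.dist_le x y).trans_lt h.bound_lt⟩

/-- Comparison of cosines is comparison of distances. -/
lemma dist_le_of_cos_le (h : IsSmallCAT X s R) {x y z w : X}
    (hc : Real.cos (s * dist x y) ≤ Real.cos (s * dist z w)) : dist z w ≤ dist x y := by
  by_contra! hlt
  have := Real.cos_lt_cos_of_nonneg_of_le_pi (h.scaled_nonneg x y)
    (by linarith [h.dist_le z w, h.bound_lt, Real.pi_pos])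
    (mul_lt_mul_of_pos_left hlt h.scale_pos)
  linarith

/-- The comparison inequality at a midpoint. -/
lemma cos_add_cos_le (h : IsSmallCAT X s R) (x : X) {y z : X} {γ : ℝ → X}
    (hγ : IsGeodesic γ y z) :
    Real.cos (s * dist x y) + Real.cos (s * dist x z) ≤
      2 * Real.cos (s * dist y z / 2) * Real.cos (s * dist x (γ (1 / 2))) := by
  -- The main case cancels the sine of half the side, which vanishes when `y = z`; there the
  -- geodesic is constant.
  rcases eq_or_ne y z with rfl | hne
  · have hd := hγ.dist_eq 0 (by simp) (1 / 2) (by norm_num)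
    rw [dist_self, zero_mul, hγ.source] at hd
    rw [← dist_eq_zero.1 hd]
    simp [two_mul]
  · have hpos : 0 < s * dist y z / 2 := by
      have := mul_pos h.scale_pos (dist_pos.2 hne)
      positivity
    have hsin : 0 < Real.sin (s * dist y z / 2) :=
      Real.sin_pos_of_pos_of_lt_pi hpos
        (by linarith [h.dist_le y z, h.bound_lt, Real.pi_pos])
    have key := h.sin_mul_cos_le x y z γ hγ (1 / 2) (by norm_num)
    have e1 : (1 - 1 / 2) * (s * dist y z) = s * dist y z / 2 := by ring
    have e2 : 1 / 2 * (s * dist y z) = s * dist y z / 2 := by ring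
    have e3 : Real.sin (s * dist y z) =
        2 * Real.sin (s * dist y z / 2) * Real.cos (s * dist y z / 2) := by
      rw [← Real.sin_two_mul]; congr 1; ring
    rw [e1, e2, e3] at key
    refine le_of_mul_le_mul_left ?_ hsin
    linarith

/-- A function whose cosine is strictly concave along geodesics, in the quantitative sense of the
sphere, has a unique minimizer on a closed convex set. -/
theorem exists_unique_minimizer [CompleteSpace X] (h : IsSmallCAT X s R) {C : Set X}
    (hC : IsClosed C) (hconv : IsGeodesicallyConvex C) (hne : C.Nonempty) {f : X → ℝ}
    (hf : Continuous f) (hf0 : ∀ p, 0 ≤ f p) (hfR : ∀ p, f p < Real.pi / 2)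
    (hmid : ∀ y z γ, IsGeodesic γ y z →
      Real.cos (f y) + Real.cos (f z) ≤
        2 * Real.cos (s * dist y z / 2) * Real.cos (f (γ (1 / 2)))) :
    ∃ p ∈ C, (∀ q ∈ C, f p ≤ f q) ∧ ∀ q ∈ C, f q ≤ f p → q = p := by
  set μ := sInf (f '' C) with hμ
  have hbdd : BddBelow (f '' C) := ⟨0, by rintro _ ⟨p, -, rfl⟩; exact hf0 p⟩
  have hμle : ∀ p ∈ C, μ ≤ f p := fun p hp => csInf_le hbdd ⟨p, hp, rfl⟩
  have hμ0 : 0 ≤ μ := le_csInf (hne.image f) (by rintro _ ⟨p, -, rfl⟩; exact hf0 p)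
  have hμlt : μ < Real.pi / 2 := by
    obtain ⟨p, hp⟩ := hne
    exact (hμle p hp).trans_lt (hfR p)
  have hcosμ : 0 < Real.cos μ :=
    Real.cos_pos_of_mem_Ioo ⟨by linarith [Real.pi_pos], hμlt⟩
  -- Near-minimizers cluster. If two of them were at distance at least `ε`, the concavity inequality
  -- would push the value at their midpoint below the infimum `μ`.
  have key : ∀ ε > 0, ∃ δ > 0, ∀ p ∈ C, ∀ q ∈ C, f p < μ + δ → f q < μ + δ → dist p q < ε := by
    intro ε hε
    -- Capping the angle at `1` keeps it in `[0, π]`, where cosine decreases, however large `ε` is.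
    have hm : 0 < min (s * ε / 2) 1 :=
      lt_min (by have := mul_pos h.scale_pos hε; positivity) one_pos
    set c := Real.cos (min (s * ε / 2) 1) with hcdef
    have hc1 : c < 1 := by
      refine lt_of_lt_of_eq ?_ Real.cos_zero
      exact Real.cos_lt_cos_of_nonneg_of_le_pi le_rfl
        ((min_le_right _ _).trans (by linarith [Real.pi_gt_three])) hm
    have hev : ∀ᶠ u in 𝓝 μ, Real.cos μ * c < Real.cos u :=
      Real.continuous_cos.continuousAt.eventually (lt_mem_nhds (by nlinarith))
    obtain ⟨δ, hδ, hball⟩ := Metric.eventually_nhds_iff.1 hev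
    refine ⟨δ, hδ, fun p hp q hq hfp hfq => ?_⟩
    by_contra! hpq
    have hcp := hball (y := f p)
      (by rw [Real.dist_eq, abs_of_nonneg (by linarith [hμle p hp])]; linarith)
    have hcq := hball (y := f q)
      (by rw [Real.dist_eq, abs_of_nonneg (by linarith [hμle q hq])]; linarith)
    obtain ⟨⟨γ, hγ⟩, hsub⟩ := hconv p hp q hq
    have hmC : γ (1 / 2) ∈ C := hsub γ hγ ⟨1 / 2, by norm_num, rfl⟩
    have hcm : Real.cos (f (γ (1 / 2))) ≤ Real.cos μ :=
      Real.cos_le_cos_of_nonneg_of_le_pi hμ0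
        (by linarith [hfR (γ (1 / 2)), Real.pi_pos]) (hμle _ hmC)
    have hθ : Real.cos (s * dist p q / 2) ≤ c :=
      Real.cos_le_cos_of_nonneg_of_le_pi hm.le
        (by linarith [h.dist_le p q, h.bound_lt, Real.pi_pos])
        ((min_le_left _ _).trans (by
          have := mul_le_mul_of_nonneg_left hpq h.scale_pos.le
          linarith))
    have hθ0 : 0 ≤ Real.cos (s * dist p q / 2) :=
      Real.cos_nonneg_of_mem_Icc ⟨by linarith [h.scaled_nonneg p q, Real.pi_pos],
        by linarith [h.dist_le p q, h.bound_lt, h.scaled_nonneg p q]⟩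
    have h1 := hmid p q γ hγ
    have h2 : Real.cos (s * dist p q / 2) * Real.cos (f (γ (1 / 2))) ≤ c * Real.cos μ :=
      (mul_le_mul_of_nonneg_left hcm hθ0).trans (mul_le_mul_of_nonneg_right hθ hcosμ.le)
    linarith
  have hex : ∀ n : ℕ, ∃ p ∈ C, f p < μ + 1 / ((n : ℝ) + 1) := by
    intro n
    obtain ⟨_, ⟨p, hp, rfl⟩, hlt⟩ := exists_lt_of_csInf_lt (hne.image f)
      (show sInf (f '' C) < μ + 1 / ((n : ℝ) + 1) by
        rw [← hμ]; linarith [Nat.one_div_pos_of_nat (α := ℝ) (n := n)])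
    exact ⟨p, hp, hlt⟩
  choose u huC hu using hex
  have hcauchy : CauchySeq u := by
    rw [Metric.cauchySeq_iff]
    intro ε hε
    obtain ⟨δ, hδ, hk⟩ := key ε hε
    obtain ⟨N, hN⟩ := exists_nat_one_div_lt hδ
    have hsmall : ∀ n ≥ N, f (u n) < μ + δ := fun n hn => by
      have := Nat.one_div_le_one_div (α := ℝ) hn
      linarith [hu n]
    exact ⟨N, fun m hm n hn => hk _ (huC m) _ (huC n) (hsmall m hm) (hsmall n hn)⟩
  obtain ⟨p, hp⟩ := cauchySeq_tendsto_of_complete hcauchy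
  have hpC : p ∈ C := hC.mem_of_tendsto hp (Eventually.of_forall huC)
  have hfp : f p ≤ μ := by
    have h1 : Tendsto (fun n : ℕ => μ + 1 / ((n : ℝ) + 1)) atTop (𝓝 (μ + 0)) :=
      tendsto_const_nhds.add tendsto_one_div_add_atTop_nhds_zero_nat
    rw [add_zero] at h1
    exact le_of_tendsto_of_tendsto' ((hf.tendsto p).comp hp) h1 fun n => (hu n).le
  refine ⟨p, hpC, fun q hq => hfp.trans (hμle q hq), fun q hq hqp => ?_⟩
  refine dist_le_zero.1 (le_of_forall_pos_le_add fun ε hε => ?_)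
  obtain ⟨δ, hδ, hk⟩ := key ε hε
  linarith [hk q hq p hpC (by linarith) (by linarith)]

/-! ### Metric projections and the Pythagorean inequality. -/

section Projection

variable {C : Set X}

/-- The metric projection onto a closed convex set is the nearest point. -/
theorem metricProj_spec [CompleteSpace X] (h : IsSmallCAT X s R) (hC : IsClosed C)
    (hconv : IsGeodesicallyConvex C) (hne : C.Nonempty) (x : X) :
    metricProj C x ∈ C ∧ dist x (metricProj C x) = Metric.infDist x C := by
  obtain ⟨p, hp, hmin, huniq⟩ := h.exists_unique_minimizer hC hconv hne
    (f := fun y => s * dist x y) (by fun_prop) (h.scaled_nonneg x)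
    (fun y => (h.dist_le x y).trans_lt h.bound_lt) (fun y z γ hγ => h.cos_add_cos_le x hγ)
  have hinf : dist x p = Metric.infDist x C :=
    le_antisymm ((Metric.le_infDist hne).2 fun {q} hq =>
      le_of_mul_le_mul_left (hmin q hq) h.scale_pos) (Metric.infDist_le_dist_of_mem hp)
  -- Without uniqueness `metricProj` would return its default value `x`.
  have hex : ∃! p, p ∈ C ∧ dist x p = Metric.infDist x C :=
    ⟨p, ⟨hp, hinf⟩, fun q hq => huniq q hq.1 (by rw [hq.2, hinf])⟩
  rw [metricProj, dif_pos hex]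
  exact hex.choose_spec.1

/-- A Pythagorean inequality for the nearest point of a convex set. -/
theorem cos_dist_le_of_isNearest (h : IsSmallCAT X s R) (hconv : IsGeodesicallyConvex C)
    {x p c : X} (hp : p ∈ C) (hmin : ∀ q ∈ C, dist x p ≤ dist x q) (hc : c ∈ C) :
    Real.cos (s * dist x c) ≤ Real.cos (s * dist x p) * Real.cos (s * dist p c) := by
  rcases eq_or_ne p c with rfl | hpc
  · simp
  set θ := s * dist p c with hθ
  have hθ0 : 0 < θ := mul_pos h.scale_pos (dist_pos.2 hpc)
  have hθ1 : θ < Real.pi / 2 := (h.dist_le p c).trans_lt h.bound_lt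
  obtain ⟨⟨γ, hγ⟩, hsub⟩ := hconv p hp c hc
  -- No point `γ t` is nearer to `x` than `p`. In the resulting inequality both `sin (t * θ)` and
  -- `sin θ - sin ((1 - t) * θ)` carry the factor `2 * sin (t * θ / 2)`; once it is cancelled,
  -- letting `t → 0` gives the claim.
  have hineq : ∀ t ∈ Ioc (0 : ℝ) 1, Real.cos (t * θ / 2) * Real.cos (s * dist x c) ≤
      Real.cos (s * dist x p) * Real.cos ((1 - t / 2) * θ) := by
    intro t ht
    have htI : t ∈ Icc (0 : ℝ) 1 := ⟨ht.1.le, ht.2⟩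
    have hle : Real.cos (s * dist x (γ t)) ≤ Real.cos (s * dist x p) :=
      Real.cos_le_cos_of_nonneg_of_le_pi (h.scaled_nonneg _ _)
        (by linarith [h.dist_le x (γ t), h.bound_lt, Real.pi_pos])
        (mul_le_mul_of_nonneg_left (hmin _ (hsub γ hγ ⟨t, htI, rfl⟩)) h.scale_pos.le)
    have key := h.sin_mul_cos_le x p c γ hγ t htI
    rw [← hθ] at key
    have hsθ : 0 ≤ Real.sin θ := Real.sin_nonneg_of_nonneg_of_le_pi hθ0.le (by linarith)
    have key2 := key.trans (mul_le_mul_of_nonneg_left hle hsθ)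
    have hst : 0 < Real.sin (t * θ / 2) :=
      Real.sin_pos_of_pos_of_lt_pi (by have := mul_pos ht.1 hθ0; positivity)
        (by nlinarith [ht.1, ht.2])
    have e1 : Real.sin (t * θ) = 2 * Real.sin (t * θ / 2) * Real.cos (t * θ / 2) := by
      rw [← Real.sin_two_mul]; congr 1; ring
    have e2 : Real.sin θ - Real.sin ((1 - t) * θ) =
        2 * Real.sin (t * θ / 2) * Real.cos ((1 - t / 2) * θ) := by
      rw [Real.sin_sub_sin]; congr 2 <;> ring_nf
    refine le_of_mul_le_mul_left ?_ (mul_pos two_pos hst)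
    rw [e1] at key2
    linear_combination key2 + Real.cos (s * dist x p) * e2
  have hc1 : Continuous fun t : ℝ => Real.cos (t * θ / 2) * Real.cos (s * dist x c) := by
    fun_prop
  have hc2 : Continuous fun t : ℝ => Real.cos (s * dist x p) * Real.cos ((1 - t / 2) * θ) := by
    fun_prop
  have ht1 := (hc1.tendsto 0).mono_left (nhdsWithin_le_nhds (s := Ioi 0))
  have ht2 := (hc2.tendsto 0).mono_left (nhdsWithin_le_nhds (s := Ioi 0))
  have := le_of_tendsto_of_tendsto ht1 ht2
    (Filter.mem_of_superset (Ioc_mem_nhdsGT one_pos) hineq)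
  simpa using this

theorem cos_dist_le_metricProj [CompleteSpace X] (h : IsSmallCAT X s R) (hC : IsClosed C)
    (hconv : IsGeodesicallyConvex C) (x : X) {c : X} (hc : c ∈ C) :
    Real.cos (s * dist x c) ≤
      Real.cos (s * dist x (metricProj C x)) * Real.cos (s * dist (metricProj C x) c) := by
  obtain ⟨hp, hd⟩ := h.metricProj_spec hC hconv ⟨c, hc⟩ x
  exact h.cos_dist_le_of_isNearest hconv hp
    (fun q hq => hd.trans_le (Metric.infDist_le_dist_of_mem hq)) hc

/-- Projecting onto `C` does not increase the distance to points of `C`. -/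
theorem dist_metricProj_le [CompleteSpace X] (h : IsSmallCAT X s R) (hC : IsClosed C)
    (hconv : IsGeodesicallyConvex C) (x : X) {c : X} (hc : c ∈ C) :
    dist (metricProj C x) c ≤ dist x c := by
  refine h.dist_le_of_cos_le ((h.cos_dist_le_metricProj hC hconv x hc).trans ?_)
  have h1 := (h.cos_scaled_pos (metricProj C x) c).le
  have h2 := Real.cos_le_one (s * dist x (metricProj C x))
  nlinarith

end Projection

/-! ### Asymptotic radii and centers. -/

section AsymptoticCenter

/-- A real `limsup` carries information only for bounded sequences; this and the next lemma supply
the two bounds. -/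
lemma isBoundedUnder_le (h : IsSmallCAT X s R) (p : X) (y : ℕ → X) :
    IsBoundedUnder (· ≤ ·) atTop fun n => dist p (y n) :=
  isBoundedUnder_of ⟨R / s, fun n => by
    rw [le_div_iff₀ h.scale_pos, mul_comm]; exact h.dist_le _ _⟩

lemma isBoundedUnder_dist_ge (p : X) (y : ℕ → X) :
    IsBoundedUnder (· ≥ ·) atTop fun n => dist p (y n) :=
  isBoundedUnder_of ⟨0, fun _ => dist_nonneg⟩

lemma radiusAt_le_of_eventually {p : X} {y : ℕ → X} {r : ℝ}
    (hr : ∀ᶠ n in atTop, dist p (y n) ≤ r) : radiusAt p y ≤ r :=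
  limsup_le_of_le (isBoundedUnder_dist_ge p y).isCoboundedUnder_le hr

lemma radiusAt_nonneg (h : IsSmallCAT X s R) (p : X) (y : ℕ → X) : 0 ≤ radiusAt p y :=
  le_limsup_of_frequently_le (Frequently.of_forall fun _ => dist_nonneg)
    (h.isBoundedUnder_le p y)

lemma radiusAt_lt (h : IsSmallCAT X s R) (p : X) (y : ℕ → X) :
    s * radiusAt p y < Real.pi / 2 := by
  have : radiusAt p y ≤ R / s := radiusAt_le_of_eventually (Eventually.of_forall fun n => by
    rw [le_div_iff₀ h.scale_pos, mul_comm]; exact h.dist_le _ _)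
  rw [le_div_iff₀ h.scale_pos, mul_comm] at this
  exact this.trans_lt h.bound_lt

lemma eventually_dist_lt (h : IsSmallCAT X s R) {p : X} {y : ℕ → X} {r : ℝ}
    (hr : radiusAt p y < r) : ∀ᶠ n in atTop, dist p (y n) < r :=
  eventually_lt_of_limsup_lt hr (h.isBoundedUnder_le p y)

lemma radiusAt_le_add_dist (h : IsSmallCAT X s R) (p q : X) (y : ℕ → X) :
    radiusAt p y ≤ radiusAt q y + dist p q := by
  refine le_of_forall_pos_le_add fun ε hε => radiusAt_le_of_eventually ?_
  filter_upwards [h.eventually_dist_lt (show radiusAt q y < radiusAt q y + ε by linarith)]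
    with n hn
  linarith [dist_triangle p q (y n)]

lemma continuous_radiusAt (h : IsSmallCAT X s R) (y : ℕ → X) :
    Continuous fun p => radiusAt p y := by
  refine (LipschitzWith.of_dist_le_mul (K := 1) fun p q => ?_).continuous
  rw [Real.dist_eq, NNReal.coe_one, one_mul]
  exact abs_le.2 ⟨by linarith [h.radiusAt_le_add_dist q p y, dist_comm p q],
    by linarith [h.radiusAt_le_add_dist p q y]⟩

/-- The midpoint inequality, applied to `y n` for large `n`, passes to the upper limit. This is the
hypothesis `exists_unique_minimizer` needs for the asymptotic radius. -/
lemma cos_radiusAt_add_le (h : IsSmallCAT X s R) (y : ℕ → X) {p q : X} {γ : ℝ → X}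
    (hγ : IsGeodesic γ p q) :
    Real.cos (s * radiusAt p y) + Real.cos (s * radiusAt q y) ≤
      2 * Real.cos (s * dist p q / 2) * Real.cos (s * radiusAt (γ (1 / 2)) y) := by
  have hs := h.scale_pos
  set θ := s * dist p q / 2 with hθ
  have hcθ : 0 < Real.cos θ :=
    Real.cos_pos_of_mem_Ioo ⟨by linarith [h.scaled_nonneg p q, Real.pi_pos],
      by linarith [h.dist_le p q, h.bound_lt, h.scaled_nonneg p q]⟩
  set m := γ (1 / 2)
  -- An upper limit gives eventual bounds only with slack, so the inequality is proved with a small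
  -- `δ > 0` added to both radii, and then `δ → 0`.
  have hδ : ∀ᶠ δ in 𝓝[>] (0 : ℝ), Real.cos (s * (radiusAt p y + δ)) +
      Real.cos (s * (radiusAt q y + δ)) ≤ 2 * Real.cos θ * Real.cos (s * radiusAt m y) := by
    have hsm : ∀ r : X, ∀ᶠ δ in 𝓝[>] (0 : ℝ), s * (radiusAt r y + δ) < Real.pi / 2 := by
      intro r
      have hcont : Continuous fun δ : ℝ => s * (radiusAt r y + δ) := by fun_prop
      refine ((hcont.tendsto 0).mono_left nhdsWithin_le_nhds).eventually (gt_mem_nhds ?_)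
      rw [add_zero]
      exact h.radiusAt_lt r y
    filter_upwards [hsm p, hsm q, self_mem_nhdsWithin] with δ h1 h2 h3
    have h3 : 0 < δ := h3
    -- An eventual lower bound for the cosine of the distance from the midpoint; once it is known to
    -- lie in `[0, 1]`, `arccos` turns it into an upper bound for the radius.
    set K := (Real.cos (s * (radiusAt p y + δ)) + Real.cos (s * (radiusAt q y + δ))) /
      (2 * Real.cos θ) with hK
    have hcos : ∀ᶠ n in atTop, K ≤ Real.cos (s * dist m (y n)) := by
      filter_upwards [h.eventually_dist_lt (show radiusAt p y < radiusAt p y + δ by linarith),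
        h.eventually_dist_lt (show radiusAt q y < radiusAt q y + δ by linarith)] with n hp hq
      have hmid : _ ≤ 2 * Real.cos θ * Real.cos (s * dist (y n) m) := h.cos_add_cos_le (y n) hγ
      rw [dist_comm (y n) p, dist_comm (y n) q, dist_comm (y n) m] at hmid
      have c1 := Real.cos_le_cos_of_nonneg_of_le_pi (h.scaled_nonneg p (y n))
        (by linarith [Real.pi_pos]) (mul_le_mul_of_nonneg_left hp.le hs.le)
      have c2 := Real.cos_le_cos_of_nonneg_of_le_pi (h.scaled_nonneg q (y n))
        (by linarith [Real.pi_pos]) (mul_le_mul_of_nonneg_left hq.le hs.le)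
      rw [hK, div_le_iff₀ (by positivity)]
      linarith
    have hK1 : K ≤ 1 := by
      obtain ⟨n, hn⟩ := hcos.exists
      exact hn.trans (Real.cos_le_one _)
    have hK0 : 0 ≤ K := by
      refine div_nonneg (add_nonneg ?_ ?_) (by positivity)
      · exact Real.cos_nonneg_of_mem_Icc ⟨by
          have := mul_nonneg hs.le (add_nonneg (h.radiusAt_nonneg p y) h3.le)
          linarith [Real.pi_pos], h1.le⟩
      · exact Real.cos_nonneg_of_mem_Icc ⟨by
          have := mul_nonneg hs.le (add_nonneg (h.radiusAt_nonneg q y) h3.le)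
          linarith [Real.pi_pos], h2.le⟩
    have hrad : radiusAt m y ≤ Real.arccos K / s := radiusAt_le_of_eventually (by
      filter_upwards [hcos] with n hn
      rw [le_div_iff₀ hs, mul_comm, ← Real.arccos_cos (h.scaled_nonneg m (y n))
        (by linarith [h.dist_le m (y n), h.bound_lt, Real.pi_pos])]
      exact Real.arccos_le_arccos hn)
    rw [le_div_iff₀ hs, mul_comm] at hrad
    have hfin := Real.cos_le_cos_of_nonneg_of_le_pi
      (mul_nonneg hs.le (h.radiusAt_nonneg m y)) (Real.arccos_le_pi K) hrad
    rw [Real.cos_arccos (by linarith) hK1, hK, div_le_iff₀ (by positivity)] at hfin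
    linarith
  have hcont : Continuous fun δ : ℝ => Real.cos (s * (radiusAt p y + δ)) +
      Real.cos (s * (radiusAt q y + δ)) := by fun_prop
  have hlim := (hcont.tendsto 0).mono_left (nhdsWithin_le_nhds (s := Ioi 0))
  simpa using le_of_tendsto hlim hδ

/-- Every sequence has a unique asymptotic center. -/
theorem exists_asymptoticCenter_eq [CompleteSpace X] [Nonempty X] (h : IsSmallCAT X s R)
    (y : ℕ → X) :
    ∃ p, asymptoticCenter y = {p} ∧ (∀ q, radiusAt p y ≤ radiusAt q y) ∧
      ∀ q, radiusAt q y ≤ radiusAt p y → q = p := by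
  have hs := h.scale_pos
  obtain ⟨p, -, hmin, huniq⟩ := h.exists_unique_minimizer (C := univ) isClosed_univ
    (fun x _ z _ => ⟨h.geodesic x z, fun _ _ => subset_univ _⟩) univ_nonempty
    (f := fun q => s * radiusAt q y) (continuous_const.mul (h.continuous_radiusAt y))
    (fun q => mul_nonneg hs.le (h.radiusAt_nonneg q y)) (fun q => h.radiusAt_lt q y)
    (fun _ _ _ hγ => h.cos_radiusAt_add_le y hγ)
  have hmin' : ∀ q, radiusAt p y ≤ radiusAt q y := fun q =>
    le_of_mul_le_mul_left (hmin q (mem_univ q)) hs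
  have huniq' : ∀ q, radiusAt q y ≤ radiusAt p y → q = p := fun q hq =>
    huniq q (mem_univ q) (mul_le_mul_of_nonneg_left hq hs.le)
  have hrad : asymptoticRadius y = radiusAt p y :=
    le_antisymm (ciInf_le ⟨0, by rintro _ ⟨q, rfl⟩; exact h.radiusAt_nonneg q y⟩ p)
      (le_ciInf hmin')
  refine ⟨p, ?_, hmin', huniq'⟩
  ext q
  simp only [asymptoticCenter, mem_ofPred_eq, mem_singleton_iff, hrad]
  exact ⟨fun hq => huniq' q hq.le, fun hq => by rw [hq]⟩

/-- The asymptotic center of a sequence approaching a closed convex set lies in that set. -/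
theorem mem_of_tendsto_infDist [CompleteSpace X] (h : IsSmallCAT X s R) {C : Set X}
    (hC : IsClosed C) (hconv : IsGeodesicallyConvex C) (hne : C.Nonempty) {y : ℕ → X} {p : X}
    (huniq : ∀ q, radiusAt q y ≤ radiusAt p y → q = p)
    (hy : Tendsto (fun n => Metric.infDist (y n) C) atTop (𝓝 0)) : p ∈ C := by
  -- Projecting `p` brings it no farther from nearby points of `C`, hence does not increase its
  -- radius; uniqueness of the center then fixes `p`.
  suffices metricProj C p = p by
    rw [← this]; exact (h.metricProj_spec hC hconv hne p).1
  refine huniq _ (le_of_forall_pos_le_add fun ε hε => radiusAt_le_of_eventually ?_)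
  filter_upwards [h.eventually_dist_lt
    (show radiusAt p y < radiusAt p y + ε / 3 by linarith),
    hy.eventually (gt_mem_nhds (show (0 : ℝ) < ε / 3 by linarith))] with n h1 h2
  obtain ⟨c, hc, hyc⟩ := (Metric.infDist_lt_iff hne).1 h2
  have h3 := h.dist_metricProj_le hC hconv p hc
  linarith [dist_triangle (metricProj C p) c (y n), dist_triangle p (y n) c, dist_comm c (y n)]

end AsymptoticCenter

end IsSmallCAT

/-! ### Fejér monotonicity and the alternating iteration. -/

/-- A sequence that is Fejér monotone with respect to a closed set and approaches it converges to
a point of the set, at the rate of its distance to the set. -/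
theorem exists_tendsto_of_fejer {X : Type*} [MetricSpace X] [CompleteSpace X] {C : Set X}
    (hC : IsClosed C) (hne : C.Nonempty) {x : ℕ → X}
    (hfejer : ∀ q ∈ C, Antitone fun n => dist (x n) q)
    (hlim : Tendsto (fun n => Metric.infDist (x n) C) atTop (𝓝 0)) :
    ∃ p ∈ C, Tendsto x atTop (𝓝 p) ∧ ∀ n, dist (x n) p ≤ 2 * Metric.infDist (x n) C := by
  -- An almost nearest point of `C` to `x N` stays at least as close to all later terms, so any two
  -- of them are within twice that distance.
  have hb : ∀ n m N : ℕ, N ≤ n → N ≤ m → dist (x n) (x m) ≤ 2 * Metric.infDist (x N) C := by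
    intro n m N hn hm
    refine le_of_forall_pos_le_add fun ε hε => ?_
    obtain ⟨c, hc, hlt⟩ := (Metric.infDist_lt_iff hne).1
      (show Metric.infDist (x N) C < Metric.infDist (x N) C + ε / 2 by linarith)
    have h1 : dist (x n) c ≤ dist (x N) c := hfejer c hc hn
    have h2 : dist (x m) c ≤ dist (x N) c := hfejer c hc hm
    linarith [dist_triangle_right (x n) (x m) c]
  have hlim2 : Tendsto (fun n => 2 * Metric.infDist (x n) C) atTop (𝓝 0) := by
    simpa using hlim.const_mul 2
  obtain ⟨p, hp⟩ := cauchySeq_tendsto_of_complete (cauchySeq_of_le_tendsto_0 _ hb hlim2)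
  refine ⟨p, ?_, hp, fun n => ?_⟩
  · rw [hC.mem_iff_infDist_zero hne]
    exact tendsto_nhds_unique (((Metric.continuous_infDist_pt C).tendsto p).comp hp) hlim
  · exact le_of_tendsto (tendsto_const_nhds.dist hp)
      (eventually_atTop.2 ⟨n, fun m hm => hb n m n le_rfl hm⟩)

/-- One step of the alternating projection method. -/
lemma IsAlternatingProjection.succ_eq {X : Type*} [MetricSpace X] {A B : Set X} {x : ℕ → X}
    (hx : IsAlternatingProjection A B x) (n : ℕ) :
    (Even n ∧ x (n + 1) = metricProj A (x n)) ∨ (Odd n ∧ x (n + 1) = metricProj B (x n)) := by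
  rcases Nat.even_or_odd' n with ⟨m, rfl | rfl⟩
  · exact Or.inl ⟨even_two_mul m, (hx m).1⟩
  · exact Or.inr ⟨odd_two_mul_add_one m, (hx m).2⟩

namespace IsSmallCAT

variable {X : Type*} [MetricSpace X] [CompleteSpace X] {s R : ℝ} {A B : Set X} {x : ℕ → X}

lemma cos_dist_alternating_le (h : IsSmallCAT X s R) (hAc : IsClosed A) (hBc : IsClosed B)
    (hA : IsGeodesicallyConvex A) (hB : IsGeodesicallyConvex B)
    (hx : IsAlternatingProjection A B x) {q : X} (hq : q ∈ A ∩ B) (n : ℕ) :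
    Real.cos (s * dist (x n) q) ≤
      Real.cos (s * dist (x n) (x (n + 1))) * Real.cos (s * dist (x (n + 1)) q) := by
  rcases hx.succ_eq n with ⟨-, e⟩ | ⟨-, e⟩
  · rw [e]; exact h.cos_dist_le_metricProj hAc hA _ hq.1
  · rw [e]; exact h.cos_dist_le_metricProj hBc hB _ hq.2

lemma antitone_dist_alternating (h : IsSmallCAT X s R) (hAc : IsClosed A) (hBc : IsClosed B)
    (hA : IsGeodesicallyConvex A) (hB : IsGeodesicallyConvex B)
    (hx : IsAlternatingProjection A B x) {q : X} (hq : q ∈ A ∩ B) :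
    Antitone fun n => dist (x n) q := by
  refine antitone_nat_of_succ_le fun n => ?_
  rcases hx.succ_eq n with ⟨-, e⟩ | ⟨-, e⟩
  · rw [e]; exact h.dist_metricProj_le hAc hA _ hq.1
  · rw [e]; exact h.dist_metricProj_le hBc hB _ hq.2

/-- From index `1` on, each iterate lies in one of the sets, and the next step is its distance to
the other. The shift matters because `x 0` need not lie in either set. -/
lemma max_infDist_alternating_le (h : IsSmallCAT X s R) (hAc : IsClosed A) (hBc : IsClosed B)
    (hA : IsGeodesicallyConvex A) (hB : IsGeodesicallyConvex B) (hAB : (A ∩ B).Nonempty)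
    (hx : IsAlternatingProjection A B x) (n : ℕ) :
    max (Metric.infDist (x (n + 1)) A) (Metric.infDist (x (n + 1)) B) ≤
      dist (x (n + 1)) (x (n + 2)) := by
  have hneA : A.Nonempty := hAB.mono inter_subset_left
  have hneB : B.Nonempty := hAB.mono inter_subset_right
  rcases hx.succ_eq n with ⟨he, e⟩ | ⟨ho, e⟩
  · rcases hx.succ_eq (n + 1) with ⟨he', -⟩ | ⟨-, e'⟩
    · exact absurd he (Nat.even_add_one.1 he')
    · have h1 : x (n + 1) ∈ A := by rw [e]; exact (h.metricProj_spec hAc hA hneA _).1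
      rw [Metric.infDist_zero_of_mem h1, e', (h.metricProj_spec hBc hB hneB _).2]
      exact max_le Metric.infDist_nonneg le_rfl
  · rcases hx.succ_eq (n + 1) with ⟨-, e'⟩ | ⟨ho', -⟩
    · have h1 : x (n + 1) ∈ B := by rw [e]; exact (h.metricProj_spec hBc hB hneB _).1
      rw [Metric.infDist_zero_of_mem h1, e', (h.metricProj_spec hAc hA hneA _).2]
      exact max_le le_rfl Metric.infDist_nonneg
    · exact absurd ho' (by simpa using ho.add_one)

/-- The alternating projection method is asymptotically regular. -/
theorem tendsto_dist_alternating_succ (h : IsSmallCAT X s R) (hAc : IsClosed A)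
    (hBc : IsClosed B) (hA : IsGeodesicallyConvex A) (hB : IsGeodesicallyConvex B)
    (hAB : (A ∩ B).Nonempty) (hx : IsAlternatingProjection A B x) :
    Tendsto (fun n => dist (x n) (x (n + 1))) atTop (𝓝 0) := by
  obtain ⟨q, hq⟩ := hAB
  have hs := h.scale_pos
  have hanti := h.antitone_dist_alternating hAc hBc hA hB hx hq
  have hlim := tendsto_atTop_ciInf hanti ⟨0, by rintro _ ⟨n, rfl⟩; exact dist_nonneg⟩
  set L := ⨅ n, dist (x n) q
  have hL0 : 0 ≤ L := ge_of_tendsto' hlim fun n => dist_nonneg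
  have hLR : s * L ≤ R := le_of_tendsto' (hlim.const_mul s) fun n => h.dist_le _ _
  have hLpos : 0 < Real.cos (s * L) := Real.cos_pos_of_mem_Ioo
    ⟨by linarith [mul_nonneg hs.le hL0, Real.pi_pos], hLR.trans_lt h.bound_lt⟩
  have hcos : Tendsto (fun n => Real.cos (s * dist (x n) q)) atTop (𝓝 (Real.cos (s * L))) :=
    (Real.continuous_cos.tendsto _).comp (hlim.const_mul s)
  -- Pythagoras bounds the cosine of the step below by this quotient, whose numerator and
  -- denominator share a positive limit.
  have hratio : Tendsto
      (fun n => Real.cos (s * dist (x n) q) / Real.cos (s * dist (x (n + 1)) q)) atTop (𝓝 1) := by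
    have := hcos.div (hcos.comp (tendsto_add_atTop_nat 1)) hLpos.ne'
    rwa [div_self hLpos.ne'] at this
  have hone : Tendsto (fun n => Real.cos (s * dist (x n) (x (n + 1)))) atTop (𝓝 1) :=
    tendsto_of_tendsto_of_tendsto_of_le_of_le hratio tendsto_const_nhds
      (fun n => by
        rw [div_le_iff₀ (h.cos_scaled_pos _ _)]
        exact h.cos_dist_alternating_le hAc hBc hA hB hx hq n)
      (fun n => Real.cos_le_one _)
  have harc := (Real.continuous_arccos.tendsto 1).comp hone
  rw [Real.arccos_one] at harc
  have hscaled : Tendsto (fun n => s * dist (x n) (x (n + 1))) atTop (𝓝 0) := by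
    refine harc.congr fun n => ?_
    exact Real.arccos_cos (h.scaled_nonneg _ _)
      (by linarith [h.dist_le (x n) (x (n + 1)), h.bound_lt, Real.pi_pos])
  have := hscaled.const_mul s⁻¹
  simpa [inv_mul_cancel_left₀ hs.ne'] using this

lemma tendsto_max_infDist_alternating (h : IsSmallCAT X s R) (hAc : IsClosed A)
    (hBc : IsClosed B) (hA : IsGeodesicallyConvex A) (hB : IsGeodesicallyConvex B)
    (hAB : (A ∩ B).Nonempty) (hx : IsAlternatingProjection A B x) :
    Tendsto (fun n => max (Metric.infDist (x n) A) (Metric.infDist (x n) B)) atTop (𝓝 0) := by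
  refine (tendsto_add_atTop_iff_nat 1).1 (squeeze_zero
    (fun n => le_max_of_le_left Metric.infDist_nonneg)
    (h.max_infDist_alternating_le hAc hBc hA hB hAB hx)
    ((h.tendsto_dist_alternating_succ hAc hBc hA hB hAB hx).comp (tendsto_add_atTop_nat 1)))

/-! ### The three modes of convergence. -/

theorem exists_deltaConverges (h : IsSmallCAT X s R) (hAc : IsClosed A)
    (hBc : IsClosed B) (hA : IsGeodesicallyConvex A) (hB : IsGeodesicallyConvex B)
    (hAB : (A ∩ B).Nonempty) (hx : IsAlternatingProjection A B x) :
    ∃ p ∈ A ∩ B, DeltaConverges x p := by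
  have hmax := h.tendsto_max_infDist_alternating hAc hBc hA hB hAB hx
  have : Nonempty X := hAB.to_type
  have hmem : ∀ φ : ℕ → ℕ, StrictMono φ → ∀ p,
      (∀ q, radiusAt q (x ∘ φ) ≤ radiusAt p (x ∘ φ) → q = p) → p ∈ A ∩ B := by
    intro φ hφ p hp
    have hsub := hmax.comp hφ.tendsto_atTop
    exact ⟨h.mem_of_tendsto_infDist hAc hA (hAB.mono inter_subset_left) hp
        (squeeze_zero (fun _ => Metric.infDist_nonneg) (fun _ => le_max_left _ _) hsub),
      h.mem_of_tendsto_infDist hBc hB (hAB.mono inter_subset_right) hp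
        (squeeze_zero (fun _ => Metric.infDist_nonneg) (fun _ => le_max_right _ _) hsub)⟩
  -- On `A ∩ B` monotonicity makes the upper limit a limit, the same along every subsequence.
  have hrad : ∀ φ : ℕ → ℕ, StrictMono φ → ∀ q ∈ A ∩ B, radiusAt q (x ∘ φ) = radiusAt q x := by
    intro φ hφ q hq
    have hlim := tendsto_atTop_ciInf (h.antitone_dist_alternating hAc hBc hA hB hx hq)
      ⟨0, by rintro _ ⟨n, rfl⟩; exact dist_nonneg⟩
    simp only [dist_comm _ q] at hlim
    exact (hlim.comp hφ.tendsto_atTop).limsup_eq.trans hlim.limsup_eq.symm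
  obtain ⟨p, -, hmin, huniq⟩ := h.exists_asymptoticCenter_eq x
  have hpC : p ∈ A ∩ B := hmem id strictMono_id p huniq
  refine ⟨p, hpC, fun φ hφ => ?_⟩
  obtain ⟨q, hqc, hqmin, hquniq⟩ := h.exists_asymptoticCenter_eq (x ∘ φ)
  have hqC : q ∈ A ∩ B := hmem φ hφ q hquniq
  -- Both centers lie in `A ∩ B`, where the radii of the subsequence and of the full sequence agree,
  -- so `q` also minimizes the latter.
  have hqp : q = p := huniq q (by
    rw [← hrad φ hφ q hqC, ← hrad φ hφ p hpC]; exact hqmin p)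
  rw [hqc, hqp]

/-- The whole space is bounded, so regularity applies with `S = univ` and turns small distances to
`A` and `B` into a small distance to `A ∩ B`. The error bound is kept for the linear rate. -/
theorem exists_tendsto_of_boundedlyRegular (h : IsSmallCAT X s R) (hAc : IsClosed A)
    (hBc : IsClosed B) (hA : IsGeodesicallyConvex A) (hB : IsGeodesicallyConvex B)
    (hAB : (A ∩ B).Nonempty) (hx : IsAlternatingProjection A B x) (hreg : BoundedlyRegular A B) :
    ∃ p ∈ A ∩ B, Tendsto x atTop (𝓝 p) ∧
      ∀ n, dist (x n) p ≤ 2 * Metric.infDist (x n) (A ∩ B) := by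
  refine exists_tendsto_of_fejer (hAc.inter hBc) hAB
    (fun q hq => h.antitone_dist_alternating hAc hBc hA hB hx hq) ?_
  have hbdd : Bornology.IsBounded (univ : Set X) :=
    Metric.isBounded_iff.2 ⟨R / s, fun y _ z _ => by
      rw [le_div_iff₀ h.scale_pos, mul_comm]; exact h.dist_le y z⟩
  rw [Metric.tendsto_atTop']
  intro ε hε
  obtain ⟨δ, hδ, hle⟩ := hreg univ hbdd (ε / 2) (by linarith)
  obtain ⟨N, hN⟩ := eventually_atTop.1
    ((h.tendsto_max_infDist_alternating hAc hBc hA hB hAB hx).eventually (gt_mem_nhds hδ))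
  refine ⟨N, fun n hn => ?_⟩
  rw [Real.dist_eq, sub_zero, abs_of_nonneg Metric.infDist_nonneg]
  linarith [hle (x n) (mem_univ _) (hN n hn.le).le]

/-- Under linear regularity, the distance to the intersection contracts at every step. -/
lemma exists_sin_infDist_contraction (h : IsSmallCAT X s R) (hAc : IsClosed A)
    (hBc : IsClosed B) (hA : IsGeodesicallyConvex A) (hB : IsGeodesicallyConvex B)
    (hAB : (A ∩ B).Nonempty) (hx : IsAlternatingProjection A B x)
    (hreg : BoundedlyLinearlyRegular A B) :
    ∃ β : ℝ, 0 < β ∧ β < 1 ∧ ∀ n, Real.sin (s * Metric.infDist (x (n + 2)) (A ∩ B)) ≤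
      β * Real.sin (s * Metric.infDist (x (n + 1)) (A ∩ B)) := by
  have hs := h.scale_pos
  have hbdd : Bornology.IsBounded (univ : Set X) :=
    Metric.isBounded_iff.2 ⟨R / s, fun y _ z _ => by
      rw [le_div_iff₀ hs, mul_comm]; exact h.dist_le y z⟩
  obtain ⟨k₀, -, hk₀⟩ := hreg univ hbdd
  -- Enlarging the constant to at least `1` ensures `c < 1` below.
  set k := max k₀ 1
  have hk1 : 1 ≤ k := le_max_right _ _
  have hk : ∀ n, s * Metric.infDist (x (n + 1)) (A ∩ B) ≤
      k * (s * dist (x (n + 1)) (x (n + 2))) := by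
    intro n
    have h1 := h.max_infDist_alternating_le hAc hBc hA hB hAB hx n
    have h2 : (0 : ℝ) ≤ max (Metric.infDist (x (n + 1)) A) (Metric.infDist (x (n + 1)) B) :=
      le_max_of_le_left Metric.infDist_nonneg
    have h3 : Metric.infDist (x (n + 1)) (A ∩ B) ≤ k * dist (x (n + 1)) (x (n + 2)) :=
      (hk₀ _ (mem_univ _)).trans (mul_le_mul (le_max_left _ _) h1 h2 (by linarith))
    calc s * Metric.infDist (x (n + 1)) (A ∩ B)
        ≤ s * (k * dist (x (n + 1)) (x (n + 2))) := mul_le_mul_of_nonneg_left h3 hs.le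
      _ = k * (s * dist (x (n + 1)) (x (n + 2))) := by ring
  have hR0 : 0 ≤ R := (h.scaled_nonneg (x 0) (x 0)).trans (h.dist_le _ _)
  have hcR : 0 < Real.cos R :=
    Real.cos_pos_of_mem_Ioo ⟨by linarith [Real.pi_pos], h.bound_lt⟩
  have hπ := Real.pi_gt_three
  -- Chosen to give `c * sin D ≤ cos D' * sin e`, where `D`, `D'` are the old and new scaled
  -- distances to `A ∩ B` and `e` is the scaled step: `cos R ≤ cos D'`, while `D ≤ k * e` and
  -- Jordan's inequality control `sin e`.
  set c := Real.cos R * (2 / (Real.pi * k)) with hc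
  have hc0 : 0 < c := by positivity
  have hc1 : c < 1 := by
    have h1 : 2 / (Real.pi * k) < 1 := by
      rw [div_lt_one (by positivity)]; nlinarith
    have h2 : 0 < 2 / (Real.pi * k) := by positivity
    nlinarith [Real.cos_le_one R]
  have hβ : 0 < 1 - c ^ 2 := by nlinarith
  refine ⟨Real.sqrt (1 - c ^ 2), Real.sqrt_pos.2 hβ, ?_, fun n => ?_⟩
  · rw [Real.sqrt_lt' one_pos]; nlinarith
  have hI : ∀ m, 0 ≤ s * Metric.infDist (x m) (A ∩ B) ∧ s * Metric.infDist (x m) (A ∩ B) ≤ R := by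
    intro m
    obtain ⟨q, hq⟩ := hAB
    exact ⟨mul_nonneg hs.le Metric.infDist_nonneg, (mul_le_mul_of_nonneg_left
      (Metric.infDist_le_dist_of_mem hq) hs.le).trans (h.dist_le (x m) q)⟩
  obtain ⟨hq, hqd⟩ := h.metricProj_spec (hAc.inter hBc) (hA.inter hB) hAB (x (n + 1))
  have hstep := h.cos_dist_alternating_le hAc hBc hA hB hx hq (n + 1)
  rw [hqd] at hstep
  have hcq : Real.cos (s * dist (x (n + 1 + 1)) (metricProj (A ∩ B) (x (n + 1)))) ≤
      Real.cos (s * Metric.infDist (x (n + 2)) (A ∩ B)) :=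
    Real.cos_le_cos_of_nonneg_of_le_pi (hI (n + 2)).1
      ((h.dist_le _ _).trans (by linarith [h.bound_lt]))
      (mul_le_mul_of_nonneg_left (Metric.infDist_le_dist_of_mem hq) hs.le)
  have hstep' := hstep.trans (mul_le_mul_of_nonneg_left hcq (h.cos_scaled_pos _ _).le)
  have hkn := hk n
  have he0 := h.scaled_nonneg (x (n + 1)) (x (n + 2))
  have heR := h.dist_le (x (n + 1)) (x (n + 2))
  have hD := hI (n + 1)
  have hD' := hI (n + 2)
  change _ ≤ Real.cos (s * dist (x (n + 1)) (x (n + 2))) * _ at hstep'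
  generalize s * dist (x (n + 1)) (x (n + 2)) = e at *
  generalize s * Metric.infDist (x (n + 1)) (A ∩ B) = D at *
  generalize s * Metric.infDist (x (n + 2)) (A ∩ B) = D' at *
  have hRlt := h.bound_lt
  have hsD : 0 ≤ Real.sin D := Real.sin_nonneg_of_nonneg_of_le_pi hD.1 (by linarith)
  have hsD' : 0 ≤ Real.sin D' := Real.sin_nonneg_of_nonneg_of_le_pi hD'.1 (by linarith)
  have hcD : 0 ≤ Real.cos D := Real.cos_nonneg_of_mem_Icc ⟨by linarith, by linarith⟩
  have hcD' : Real.cos R ≤ Real.cos D' :=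
    Real.cos_le_cos_of_nonneg_of_le_pi hD'.1 (by linarith) hD'.2
  have hse : 2 / (Real.pi * k) * Real.sin D ≤ Real.sin e := by
    have h1 := Real.mul_le_sin he0 (by linarith)
    have h2 := (Real.sin_le hD.1).trans hkn
    calc 2 / (Real.pi * k) * Real.sin D ≤ 2 / (Real.pi * k) * (k * e) :=
          mul_le_mul_of_nonneg_left h2 (by positivity)
      _ = 2 / Real.pi * e := by field_simp
      _ ≤ Real.sin e := h1
  have hprod : c * Real.sin D ≤ Real.cos D' * Real.sin e := by
    calc c * Real.sin D = Real.cos R * (2 / (Real.pi * k) * Real.sin D) := by rw [hc]; ring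
      _ ≤ Real.cos D' * Real.sin e := mul_le_mul hcD' hse (by positivity) (by linarith)
  have hsq1 : (c * Real.sin D) ^ 2 ≤ (Real.cos D' * Real.sin e) ^ 2 :=
    pow_le_pow_left₀ (by positivity) hprod 2
  have hsq2 : Real.cos D ^ 2 ≤ (Real.cos e * Real.cos D') ^ 2 := pow_le_pow_left₀ hcD hstep' 2
  refine le_of_sq_le_sq ?_ (by positivity)
  rw [mul_pow, Real.sq_sqrt hβ.le]
  have t1 := Real.sin_sq_add_cos_sq D
  have t2 := Real.sin_sq_add_cos_sq D'
  have t3 := Real.sin_sq_add_cos_sq e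
  -- That is, cos² D ≤ cos² D' - cos² D' sin² e ≤ cos² D' - c² sin² D, and so sin² D' ≤ (1 - c²)
  -- sin² D.
  linear_combination hsq1 + hsq2 + t2 - t1 + Real.cos D' ^ 2 * t3

/-- The sines decay geometrically, and Jordan's inequality converts them back to distances. Its
factor `π / 2` and the factor `2` of the Fejér bound combine into `π / s`. -/
theorem exists_convergesLinearly (h : IsSmallCAT X s R) (hAc : IsClosed A)
    (hBc : IsClosed B) (hA : IsGeodesicallyConvex A) (hB : IsGeodesicallyConvex B)
    (hAB : (A ∩ B).Nonempty) (hx : IsAlternatingProjection A B x)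
    (hreg : BoundedlyLinearlyRegular A B) :
    ∃ p ∈ A ∩ B, ConvergesLinearly x p := by
  have hs := h.scale_pos
  have hreg' : BoundedlyRegular A B := fun S hS ε hε => by
    obtain ⟨k, hk, hle⟩ := hreg S hS
    refine ⟨ε / k, div_pos hε hk, fun y hy hmax => (hle y hy).trans ?_⟩
    calc k * max (Metric.infDist y A) (Metric.infDist y B) ≤ k * (ε / k) :=
          mul_le_mul_of_nonneg_left hmax hk.le
      _ = ε := by field_simp
  obtain ⟨p, hp, -, hrate⟩ := h.exists_tendsto_of_boundedlyRegular hAc hBc hA hB hAB hx hreg'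
  obtain ⟨β, hβ0, hβ1, hβ⟩ := h.exists_sin_infDist_contraction hAc hBc hA hB hAB hx hreg
  refine ⟨p, hp, ?_⟩
  have hsin : ∀ n, Real.sin (s * Metric.infDist (x (n + 1)) (A ∩ B)) ≤ β ^ n := by
    intro n
    induction n with
    | zero => simpa using Real.sin_le_one _
    | succ n ih =>
      calc _ ≤ β * Real.sin (s * Metric.infDist (x (n + 1)) (A ∩ B)) := hβ n
        _ ≤ β * β ^ n := mul_le_mul_of_nonneg_left ih hβ0.le
        _ = β ^ (n + 1) := by ring
  have hdist : ∀ n, dist (x (n + 1)) p ≤ Real.pi / s * β ^ n := by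
    intro n
    have h1 : s * Metric.infDist (x (n + 1)) (A ∩ B) ≤ Real.pi / 2 :=
      (mul_le_mul_of_nonneg_left (Metric.infDist_le_dist_of_mem hp) hs.le).trans
        ((h.dist_le _ _).trans h.bound_lt.le)
    have h2 := (Real.mul_le_sin (mul_nonneg hs.le Metric.infDist_nonneg) h1).trans (hsin n)
    have hπ := Real.pi_pos
    refine (hrate (n + 1)).trans ?_
    rw [div_mul_eq_mul_div, le_div_iff₀ hs]
    rw [div_mul_eq_mul_div, div_le_iff₀ hπ] at h2
    linarith
  have hK : 0 ≤ Real.pi / s / β := by have := Real.pi_pos; positivity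
  -- Dividing by `β` absorbs the index shift by one; the term `dist (x 0) p` covers `n = 0`, which
  -- the contraction does not reach.
  refine ⟨Real.pi / s / β + dist (x 0) p, β, add_nonneg hK dist_nonneg, hβ0.le, hβ1, fun n => ?_⟩
  cases n with
  | zero => simpa using hK
  | succ n =>
    calc dist (x (n + 1)) p ≤ Real.pi / s * β ^ n := hdist n
      _ = Real.pi / s / β * β ^ (n + 1) := by field_simp; ring
      _ ≤ (Real.pi / s / β + dist (x 0) p) * β ^ (n + 1) :=
        mul_le_mul_of_nonneg_right (by linarith [dist_nonneg (x := x 0) (y := p)])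
          (by positivity)

end IsSmallCAT

end CATSpace

theorem theorem3p6 {M : Type*} [MetricSpace M] [CompleteSpace M] {κ : ℝ} (hκ : 0 < κ)
    (hM : CATSpace.IsCAT κ M)
    (hdiam : Metric.ediam (Set.univ : Set M) < ENNReal.ofReal (CATSpace.modelDiam κ / 2))
    {A B : Set M} (hAc : IsClosed A) (hBc : IsClosed B)
    (hA : CATSpace.IsGeodesicallyConvex A) (hB : CATSpace.IsGeodesicallyConvex B)
    (hAB : (A ∩ B).Nonempty)
    {x : ℕ → M} (hx : CATSpace.IsAlternatingProjection A B x) :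
    (∃ p ∈ A ∩ B, CATSpace.DeltaConverges x p) ∧
    (CATSpace.BoundedlyRegular A B → ∃ p ∈ A ∩ B, Tendsto x atTop (𝓝 p)) ∧
    (CATSpace.BoundedlyLinearlyRegular A B → ∃ p ∈ A ∩ B, CATSpace.ConvergesLinearly x p) := by
  have h := hM.isSmallCAT hκ hdiam
  refine ⟨h.exists_deltaConverges hAc hBc hA hB hAB hx, fun hreg => ?_,
    h.exists_convergesLinearly hAc hBc hA hB hAB hx⟩
  obtain ⟨p, hp, hlim, -⟩ :=
    h.exists_tendsto_of_boundedlyRegular hAc hBc hA hB hAB hx hreg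
  exact ⟨p, hp, hlim⟩
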